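/- Let $T$ be a tree and let $G$ be a group acting faithfully on $T$ by graph automorphisms (edge inversions are allowed). An element of $G$ is called elliptic if it fixes a vertex or an unoriented edge of $T$, and hyperbolic otherwise. The boundary $\partial T$ is the set of rays (infinite paths without repeated vertices) modulo eventual coincidence up to a shift. Assume that the action is of general type, i.e. that there are two hyperbolic elements of $G$ with no common fixed point on $\partial T$. Let $T^{(1)}$ be the barycentric subdivision of $T$. For an elliptic $g \in G\setminus\{1\}$, let $\Psi_T(g)$ be the set of vertices of $T^{(1)}$ that are fixed by $g$ and have a neighbour in $T^{(1)}$ not fixed by $g$, and let $\Upsilon_T(g)$ be the smallest connected subtree of $T^{(1)}$ containing $\Psi_T(g)$. The elliptic element $g$ is called infinitely fledged if $\Upsilon_T(g)$ has infinite diameter. If $m$ is a conjugation-invariant mean on $G\setminus\{1\}$, that is, a positive, finitely additive probability measure defined on all subsets of $G\setminus\{1\}$ with $m(hAh^{-1})=m(A)$ for all $h\in G$ and $A\subseteq G\setminus\{1\}$, then $m$ is supported on the infinitely fledged elliptic elements: $$m\bigl(\{g\in G\setminus\{1\} : g \text{ is elliptic and infinitely fledged}\}\bigr)=1 .$$ 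-/

import Mathlib

namespace TreeAction

variable {V : Type*} {T : SimpleGraph V}

/-- An automorphism of a tree is elliptic if it fixes a vertex or an (unoriented) edge;
inverting an edge is allowed. -/
def IsElliptic (φ : T ≃g T) : Prop :=
  (∃ v : V, φ v = v) ∨ ∃ e : T.edgeSet, φ.mapEdgeSet e = e

/-- An automorphism of a tree is hyperbolic if it is not elliptic. -/
def IsHyperbolic (φ : T ≃g T) : Prop := ¬ IsElliptic φ

/-! ### The boundary of a tree -/

/-- A ray in `T`: an infinite path without repeated vertices (a geodesic ray if `T` is a tree). -/
@[ext]
structure Ray (T : SimpleGraph V) where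
  vertex : ℕ → V
  adj : ∀ n, T.Adj (vertex n) (vertex (n + 1))
  inj : Function.Injective vertex

/-- Two rays are cofinal if they agree from some point on, up to a shift. -/
def Ray.Cofinal (r s : Ray T) : Prop :=
  ∃ m n : ℕ, ∀ k : ℕ, r.vertex (m + k) = s.vertex (n + k)

theorem Ray.cofinal_equivalence : Equivalence (Ray.Cofinal (T := T)) where
  refl _ := ⟨0, 0, fun _ => rfl⟩
  symm := fun ⟨m, n, h⟩ => ⟨n, m, fun k => (h k).symm⟩
  trans := by
    rintro r s t ⟨m, n, h⟩ ⟨n', p, h'⟩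
    refine ⟨m + n', p + n, fun k => ?_⟩
    have h1 := h (n' + k)
    have h2 := h' (n + k)
    rw [show m + n' + k = m + (n' + k) by omega, h1,
      show n + (n' + k) = n' + (n + k) by omega, h2, show p + n + k = p + (n + k) by omega]

instance Ray.setoid (T : SimpleGraph V) : Setoid (Ray T) :=
  ⟨Ray.Cofinal, Ray.cofinal_equivalence⟩

/-- The boundary `∂T` of the tree `T`: rays up to cofinality. -/
def Boundary (T : SimpleGraph V) : Type _ := Quotient (Ray.setoid T)

/-- The image of a ray under an automorphism. -/
def Ray.map (φ : T ≃g T) (r : Ray T) : Ray T where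
  vertex n := φ (r.vertex n)
  adj n := φ.map_adj_iff.2 (r.adj n)
  inj := φ.injective.comp r.inj

/-- The map induced on the boundary by an automorphism. -/
def Boundary.map (φ : T ≃g T) : Boundary T → Boundary T :=
  Quotient.map (Ray.map φ) fun _ _ ⟨m, n, h⟩ => ⟨m, n, fun k => congrArg φ (h k)⟩

/-- Two hyperbolic automorphisms are transverse if they have no common fixed point on `∂T`. -/
def IsTransverse (φ ψ : T ≃g T) : Prop :=
  ∀ ξ : Boundary T, ¬ (Boundary.map φ ξ = ξ ∧ Boundary.map ψ ξ = ξ)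

/-- An action of `G` on the tree `T` is of general type if there are two transverse hyperbolic
elements. -/
def IsGeneralType {G : Type*} [Group G] (ρ : G →* (T ≃g T)) : Prop :=
  ∃ g h : G, IsHyperbolic (ρ g) ∧ IsHyperbolic (ρ h) ∧ IsTransverse (ρ g) (ρ h)

/-! ### The barycentric subdivision and fledged elements -/

/-- Incidence in the barycentric subdivision: a vertex of `T` is joined to (the midpoint of) each
edge that contains it. -/
def subdivisionAdj (T : SimpleGraph V) : V ⊕ T.edgeSet → V ⊕ T.edgeSet → Prop
  | .inl v, .inr e => v ∈ (e : Sym2 V)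
  | .inr e, .inl v => v ∈ (e : Sym2 V)
  | _, _ => False

/-- The barycentric subdivision `T⁽¹⁾` of `T`. -/
def subdivision (T : SimpleGraph V) : SimpleGraph (V ⊕ T.edgeSet) where
  Adj := subdivisionAdj T
  symm := ⟨by rintro (v | e) (w | f) h <;> exact h⟩
  loopless := ⟨by rintro (v | e) h <;> exact h⟩

/-- The map induced by an automorphism of `T` on the vertices of `T⁽¹⁾`. -/
def subdivisionMap (φ : T ≃g T) : V ⊕ T.edgeSet → V ⊕ T.edgeSet :=
  Sum.map φ φ.mapEdgeSet

/-- `Ψ_T(φ)`: the vertices of `T⁽¹⁾` that are fixed by `φ` and have a neighbour that is not. -/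
def frontierFix (φ : T ≃g T) : Set (V ⊕ T.edgeSet) :=
  {t | subdivisionMap φ t = t ∧ ∃ s, (subdivision T).Adj t s ∧ subdivisionMap φ s ≠ s}

/-- The vertex set of the smallest connected subgraph of the tree `H` that contains `S`. -/
def treeHull {W : Type*} (H : SimpleGraph W) (S : Set W) : Set W :=
  ⋂₀ {C : Set W | S ⊆ C ∧ (H.induce C).Preconnected}

/-- `Υ_T(φ)`: the smallest connected subtree of `T⁽¹⁾` that contains `Ψ_T(φ)`. -/
def fledge (φ : T ≃g T) : Set (V ⊕ T.edgeSet) :=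
  treeHull (subdivision T) (frontierFix φ)

/-- The diameter of a set of vertices, in the graph metric. -/
noncomputable def setDiam {W : Type*} (H : SimpleGraph W) (S : Set W) : ℕ∞ :=
  ⨆ x ∈ S, ⨆ y ∈ S, H.edist x y

/-- An element `g ≠ 1` is an infinitely fledged elliptic element if it is elliptic and `Υ_T(g)`
has infinite diameter. -/
def IsInfinitelyFledged {G : Type*} [Group G] (ρ : G →* (T ≃g T)) (g : {g : G // g ≠ 1}) : Prop :=
  IsElliptic (ρ g) ∧ setDiam (subdivision T) (fledge (ρ g)) = ⊤

/-! ### Means -/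

/-- A mean on the set `X`: a positive, finitely additive probability measure defined on all
subsets of `X`. -/
structure Mean (X : Type*) where
  measure : Set X → ℝ
  nonneg : ∀ A, 0 ≤ measure A
  univ : measure Set.univ = 1
  union : ∀ A B, Disjoint A B → measure (A ∪ B) = measure A + measure B

/-- Conjugation by `h` on `G ∖ {1}`. -/
def conjNeOne {G : Type*} [Group G] (h : G) (g : {g : G // g ≠ 1}) : {g : G // g ≠ 1} :=
  ⟨h * g * h⁻¹, fun hg => g.2 (conj_eq_one_iff.1 hg)⟩

/-- A mean on `G ∖ {1}` is conjugation invariant if `m (h A h⁻¹) = m A` for all `h` and `A`. -/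
def Mean.IsConjInvariant {G : Type*} [Group G] (m : Mean {g : G // g ≠ 1}) : Prop :=
  ∀ (h : G) (A : Set {g : G // g ≠ 1}), m.measure (conjNeOne h '' A) = m.measure A

/-- A mean is supported on `A` if `A` has full measure. -/
def Mean.IsSupportedOn {X : Type*} (m : Mean X) (A : Set X) : Prop := m.measure A = 1

end TreeAction

/-! A mean cannot live on elements that can be located equivariantly in the tree or at its ends.
Suppose each element of a conjugation-invariant family `Y` has a location, and let `a` be hyperbolic
with an axis. The elements located between a half-space of the axis and its translate by `a` have
infinitely many pairwise disjoint conjugates of equal measure, so they are null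
(`IsPlacement.measure_diff_shift`). Hence almost all of `Y` is located arbitrarily close to the two
ends of the axis. A transverse hyperbolic element concentrates `Y` near two further ends. Small
neighbourhoods of the first two ends are disjoint from those of the last two, so `Y` is null
(`IsPlacement.measure_eq_zero`).

Two families can be located. A hyperbolic element is placed at the end to which its powers push
every vertex (`isPlacement_attracted`). A finitely fledged elliptic element has a bounded, nonempty
frontier of its fixed set, and is placed at the circumcenter of that frontier
(`isPlacement_centered`). The infinitely fledged elliptic elements are all that remains. -/

namespace TreeAction

variable {V : Type*} {T : SimpleGraph V}

/-! ### Half-spaces in trees -/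

/-- The half-space of vertices that are closer to `v` than to `u`. -/
def halfSpace (T : SimpleGraph V) (u v : V) : Set V := {w | T.dist w v < T.dist w u}

theorem mem_halfSpace {u v w : V} : w ∈ halfSpace T u v ↔ T.dist w v < T.dist w u := Iff.rfl

theorem right_mem_halfSpace {u v : V} (h : T.Adj u v) : v ∈ halfSpace T u v := by
  simp [mem_halfSpace, SimpleGraph.dist_eq_one_iff_adj.2 h.symm]

theorem left_notMem_halfSpace (u v : V) : u ∉ halfSpace T u v := by
  simp [mem_halfSpace]

/-- A vertex has at most one neighbour that is closer to a given vertex. -/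
theorem eq_of_adj_of_dist_lt (hT : T.IsTree) {x u v w : V} (hu : T.Adj u v) (hw : T.Adj w v)
    (h1 : T.dist x u < T.dist x v) (h2 : T.dist x w < T.dist x v) : u = w := by
  have key : ∀ u, T.Adj u v → T.dist x u < T.dist x v →
      ∃ p : T.Walk x v, p.IsPath ∧ p.penultimate = u := by
    intro u hu h1
    obtain ⟨p, hp⟩ := hT.connected.exists_walk_length_eq_dist x u
    refine ⟨p.concat hu, (p.concat hu).isPath_of_length_eq_dist ?_, by simp⟩
    have := hT.dist_eq_dist_add_one_of_adj x hu
    rw [SimpleGraph.Walk.length_concat]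
    omega
  obtain ⟨p, hp, rfl⟩ := key u hu h1
  obtain ⟨q, hq, rfl⟩ := key w hw h2
  have := (hT.isAcyclic.subsingleton_path x v).elim ⟨p, hp⟩ ⟨q, hq⟩
  rw [Subtype.mk.injEq] at this
  rw [this]

/-- Distinct vertices have a neighbour one step closer. -/
theorem exists_adj_dist_succ (hT : T.IsTree) {x v : V} (h : x ≠ v) :
    ∃ u, T.Adj u v ∧ T.dist x u + 1 = T.dist x v := by
  obtain ⟨p, hp⟩ := hT.connected.exists_walk_length_eq_dist v x
  cases p with
  | nil => exact absurd rfl h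
  | @cons _ u _ hu q =>
    refine ⟨u, hu.symm, ?_⟩
    have h1 := hT.dist_eq_dist_add_one_of_adj x hu
    have h2 := SimpleGraph.dist_le q
    rw [SimpleGraph.Walk.length_cons] at hp
    rw [T.dist_comm (u := v)] at hp
    rw [T.dist_comm (u := u)] at h2
    omega

theorem compl_halfSpace (hT : T.IsTree) {u v : V} (h : T.Adj u v) :
    (halfSpace T u v)ᶜ = halfSpace T v u := by
  ext w
  have := hT.dist_eq_dist_add_one_of_adj w h
  simp only [Set.mem_compl_iff, mem_halfSpace]
  omega

/-- The only edge leaving a half-space is the one that defines it. -/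
theorem eq_of_adj_of_mem_halfSpace (hT : T.IsTree) {u v s t : V} (huv : T.Adj u v)
    (hs : s ∈ halfSpace T u v) (ht : t ∉ halfSpace T u v) (hst : T.Adj s t) : s = v ∧ t = u := by
  have hsv : s = v := by
    by_contra hne
    -- Both `t` and `s'` are neighbours of `s` that are closer to `u`, so they coincide. But `t` is
    -- farther from `v` than `s` is, while `s'` is closer.
    obtain ⟨s', h1, h2⟩ := exists_adj_dist_succ hT (x := v) (v := s) (Ne.symm hne)
    have e1 := hT.dist_eq_dist_add_one_of_adj s huv
    have e2 := hT.dist_eq_dist_add_one_of_adj t huv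
    have e3 := hT.dist_eq_dist_add_one_of_adj u hst
    have e4 := hT.dist_eq_dist_add_one_of_adj v hst
    have e5 := hT.dist_eq_dist_add_one_of_adj u h1
    have e6 := hT.dist_eq_dist_add_one_of_adj s' huv
    rw [mem_halfSpace] at hs ht
    simp only [T.dist_comm (v := u), T.dist_comm (v := v)] at *
    have := eq_of_adj_of_dist_lt hT (x := u) h1 hst.symm (by omega) (by omega)
    subst this
    omega
  subst hsv
  refine ⟨rfl, ?_⟩
  by_contra hne
  have e1 := hT.dist_eq_dist_add_one_of_adj t huv
  have e2 := hT.dist_eq_dist_add_one_of_adj u hst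
  rw [mem_halfSpace] at ht
  rw [SimpleGraph.dist_eq_one_iff_adj.2 hst.symm] at *
  have : T.dist t u = 0 := by omega
  exact hne (hT.connected.dist_eq_zero_iff.1 this)

/-- A geodesic that enters a half-space passes through its defining edge. -/
theorem dist_add_dist_le (hT : T.IsTree) {u v s t : V} (huv : T.Adj u v)
    (hs : s ∈ halfSpace T u v) (ht : t ∉ halfSpace T u v) :
    T.dist t u + T.dist s u ≤ T.dist t s := by
  have key : ∀ {s t : V} (p : T.Walk s t), s ∈ halfSpace T u v → t ∉ halfSpace T u v →
      T.dist t u + T.dist s u ≤ p.length := by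
    intro s t p
    induction p with
    | nil => intro h1 h2; exact absurd h1 h2
    | @cons s s' t h q ih =>
      intro h1 h2
      rw [SimpleGraph.Walk.length_cons]
      by_cases h3 : s' ∈ halfSpace T u v
      · have := ih h3 h2
        have := hT.dist_eq_dist_add_one_of_adj u h
        simp only [T.dist_comm (v := u)] at *
        omega
      · obtain ⟨rfl, rfl⟩ := eq_of_adj_of_mem_halfSpace hT huv h1 h3 h
        have := SimpleGraph.dist_le q
        rw [SimpleGraph.dist_eq_one_iff_adj.2 h, T.dist_comm]
        omega
  obtain ⟨p, hp⟩ := hT.connected.exists_walk_length_eq_dist s t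
  rw [T.dist_comm (u := t) (v := s), ← hp]
  exact key p hs ht

/-- Half-spaces are connected: a property that is preserved by edges inside a half-space holds
at one vertex only if it holds at its root. -/
theorem halfSpace_induction (hT : T.IsTree) {u v : V} (P : V → Prop)
    (hP : ∀ s t, s ∈ halfSpace T u v → t ∈ halfSpace T u v → T.Adj s t → P s → P t)
    {w : V} (hw : w ∈ halfSpace T u v) (h : P w) : P v := by
  obtain ⟨n, hn⟩ : ∃ n, T.dist v w = n := ⟨_, rfl⟩
  induction n generalizing w with
  | zero => rwa [hT.connected.dist_eq_zero_iff.1 hn]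
  | succ n ih =>
    have hne : v ≠ w := by rintro rfl; simp at hn
    obtain ⟨w', h1, h2⟩ := exists_adj_dist_succ hT hne
    have hw' : w' ∈ halfSpace T u v := by
      have := hT.dist_eq_dist_add_one_of_adj u h1
      rw [mem_halfSpace] at *
      simp only [T.dist_comm (v := u), T.dist_comm (v := v)] at *
      omega
    exact ih hw' (hP _ _ hw hw' h1.symm h) (by omega)

/-- A point violating the inclusion would have both `u` and `w` as neighbours of `v` closer to it,
and there is only one such neighbour. -/
theorem halfSpace_subset (hT : T.IsTree) {u v w : V} (huv : T.Adj u v) (hvw : T.Adj v w)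
    (hne : u ≠ w) : halfSpace T v w ⊆ halfSpace T u v := by
  intro x hx
  by_contra h
  rw [← Set.mem_compl_iff, compl_halfSpace hT huv] at h
  exact hne (eq_of_adj_of_dist_lt hT huv hvw.symm h hx)

/-! ### Automorphisms -/

theorem dist_map (hT : T.IsTree) (φ : T ≃g T) (x y : V) : T.dist (φ x) (φ y) = T.dist x y := by
  have key : ∀ (φ : T ≃g T) x y, T.dist (φ x) (φ y) ≤ T.dist x y := by
    intro φ x y
    obtain ⟨p, hp⟩ := hT.connected.exists_walk_length_eq_dist x y
    rw [← hp, ← SimpleGraph.Walk.length_map φ.toHom p]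
    exact SimpleGraph.dist_le _
  refine le_antisymm (key φ x y) ?_
  simpa using key φ.symm (φ x) (φ y)

theorem image_halfSpace (hT : T.IsTree) (φ : T ≃g T) (u v : V) :
    φ '' halfSpace T u v = halfSpace T (φ u) (φ v) := by
  ext w
  obtain ⟨w, rfl⟩ := φ.surjective w
  simp [mem_halfSpace, dist_map hT]

/-! ### Non-backtracking sequences -/

/-- If the distance to `r 0` dropped at some step, the vertices before and after the turning point
would both be its unique neighbour closer to `r 0`, which is backtracking. -/
theorem dist_of_nonbacktracking (hT : T.IsTree) {r : ℕ → V} (hadj : ∀ n, T.Adj (r n) (r (n + 1)))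
    (hne : ∀ n, r n ≠ r (n + 2)) (n : ℕ) : T.dist (r 0) (r n) = n := by
  induction n using Nat.twoStepInduction with
  | zero => simp
  | one => simpa using hadj 0
  | more n ih1 ih2 =>
    have hadj' : T.Adj (r (n + 1)) (r (n + 2)) := hadj (n + 1)
    rcases hT.dist_eq_dist_add_one_of_adj (r 0) hadj' with h | h
    · refine absurd (eq_of_adj_of_dist_lt hT (x := r 0) (hadj n) hadj'.symm ?_ ?_) (hne n)
      all_goals omega
    · omega

/-- A bi-infinite path without backtracking. -/
structure Line (T : SimpleGraph V) where
  vertex : ℤ → V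
  adj : ∀ i, T.Adj (vertex i) (vertex (i + 1))
  ne : ∀ i, vertex i ≠ vertex (i + 2)

/-! ### Bi-infinite lines, their half-spaces and their ends. -/

namespace Line

theorem dist_add (hT : T.IsTree) (ℓ : Line T) (i : ℤ) (n : ℕ) :
    T.dist (ℓ.vertex i) (ℓ.vertex (i + n)) = n := by
  simpa using dist_of_nonbacktracking hT (r := fun n : ℕ => ℓ.vertex (i + n))
    (fun n => by simpa [add_assoc] using ℓ.adj (i + n))
    (fun n => by simpa [add_assoc] using ℓ.ne (i + n)) n

theorem injective (hT : T.IsTree) (ℓ : Line T) : Function.Injective ℓ.vertex := by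
  have key : ∀ i j, i ≤ j → ℓ.vertex i = ℓ.vertex j → i = j := by
    intro i j hij h
    obtain ⟨n, rfl⟩ := Int.le.dest hij
    have := ℓ.dist_add hT i n
    rw [← h, SimpleGraph.dist_self] at this
    omega
  intro i j h
  rcases le_total i j with hij | hij
  · exact key i j hij h
  · exact (key j i hij h.symm).symm

/-- The line traversed backwards. -/
def reverse (ℓ : Line T) : Line T where
  vertex i := ℓ.vertex (-i)
  adj i := by simpa using (ℓ.adj (-(i + 1))).symm
  ne i := by
    have := (ℓ.ne (-(i + 2))).symm
    simpa using this

/-- The half-space at the `i`-th edge of a line, in its forward direction. -/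
def half (ℓ : Line T) (i : ℤ) : Set V := halfSpace T (ℓ.vertex i) (ℓ.vertex (i + 1))

theorem half_antitone (hT : T.IsTree) (ℓ : Line T) : Antitone ℓ.half :=
  antitone_int_of_succ_le fun i => halfSpace_subset hT (ℓ.adj i) (ℓ.adj (i + 1)) (by
    simpa [add_assoc] using ℓ.ne i)

theorem vertex_mem_half (hT : T.IsTree) (ℓ : Line T) {i j : ℤ} :
    ℓ.vertex j ∈ ℓ.half i ↔ i < j := by
  constructor
  · intro h
    by_contra hle
    exact left_notMem_halfSpace _ _ (ℓ.half_antitone hT (not_lt.1 hle) h)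
  · intro h
    have : ℓ.vertex j ∈ ℓ.half (j - 1) := by
      have := right_mem_halfSpace (ℓ.adj (j - 1))
      simpa [half] using this
    exact ℓ.half_antitone hT (by omega) this

theorem compl_half (hT : T.IsTree) (ℓ : Line T) (i : ℤ) :
    (ℓ.half i)ᶜ = ℓ.reverse.half (-(i + 1)) := by
  rw [half, compl_halfSpace hT (ℓ.adj i)]
  simp [half, reverse]

/-- The forward half-spaces of a line have empty intersection. -/
theorem exists_notMem_half (hT : T.IsTree) (ℓ : Line T) (x : V) :
    ∃ N : ℕ, ∀ i : ℤ, N ≤ i → x ∉ ℓ.half i := by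
  -- For `n ≥ 0`, the geodesic from `ℓ.vertex 0` to a point of `ℓ.half n` passes through `ℓ.vertex
  -- n`, so it has length at least `n`.
  refine ⟨T.dist (ℓ.vertex 0) x + 1, fun i hi hx => ?_⟩
  obtain ⟨n, rfl⟩ := Int.eq_ofNat_of_zero_le (by omega : 0 ≤ i)
  have h0 : ℓ.vertex 0 ∉ ℓ.half n := by rw [ℓ.vertex_mem_half hT]; omega
  have h1 := dist_add_dist_le hT (ℓ.adj n) hx h0
  have h2 := ℓ.dist_add hT 0 n
  rw [zero_add] at h2
  omega

/-- The ray of the vertices with non-negative index. -/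
def ray (hT : T.IsTree) (ℓ : Line T) : Ray T where
  vertex n := ℓ.vertex n
  adj n := by simpa using ℓ.adj n
  inj := (ℓ.injective hT).comp Nat.cast_injective

/-- Two lines whose forward half-spaces always meet have the same forward end. -/
theorem cofinal_of_nonempty_inter (hT : T.IsTree) (ℓ κ : Line T)
    (h : ∀ n : ℕ, (ℓ.half n ∩ κ.half n).Nonempty) : (ℓ.ray hT).Cofinal (κ.ray hT) := by
  obtain ⟨N, hN⟩ := ℓ.exists_notMem_half hT (κ.vertex 0)
  -- Beyond `N`, the line `κ` starts outside `ℓ.half n`. If it ever enters, its first entry must be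
  -- along the `n`-th edge of `ℓ`.
  have key : ∀ n : ℕ, N ≤ n → ∃ j : ℕ, κ.vertex j = ℓ.vertex n ∧
      κ.vertex (j + 1) = ℓ.vertex (n + 1) := by
    intro n hn
    have h0 := hN n (by exact_mod_cast hn)
    by_cases hex : ∃ j : ℕ, κ.vertex j ∈ ℓ.half n
    · classical
      obtain ⟨j, hj⟩ : ∃ j, Nat.find hex = j + 1 :=
        Nat.exists_eq_succ_of_ne_zero fun h1 => h0 (by simpa [h1] using Nat.find_spec hex)
      have h1 : κ.vertex ((j + 1 : ℕ) : ℤ) ∈ ℓ.half n := hj ▸ Nat.find_spec hex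
      have h2 : κ.vertex j ∉ ℓ.half n := Nat.find_min hex (by omega)
      rw [Nat.cast_succ] at h1
      obtain ⟨h3, h4⟩ := eq_of_adj_of_mem_halfSpace hT (ℓ.adj n) h1 h2 (κ.adj j).symm
      exact ⟨j, h4, h3⟩
    · push Not at hex
      -- If `κ` never enters `ℓ.half n`, no path inside `ℓ.half n` can leave `κ.half m`, as it would
      -- do so through `κ.vertex m`. The two half-spaces meet, so the root of `ℓ.half n` lies in
      -- every `κ.half m`, although these have empty intersection.
      have hall : ∀ m : ℕ, ℓ.vertex (n + 1) ∈ κ.half m := by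
        intro m
        obtain ⟨w, hw1, hw2⟩ := h (max n m)
        have hw1 := ℓ.half_antitone hT (show (n : ℤ) ≤ (max n m : ℕ) by simp) hw1
        have hw2 := κ.half_antitone hT (show (m : ℤ) ≤ (max n m : ℕ) by simp) hw2
        refine halfSpace_induction hT (fun x => x ∈ κ.half m) ?_ hw1 hw2
        intro s t hs ht hst h1
        by_contra h2
        obtain ⟨rfl, rfl⟩ := eq_of_adj_of_mem_halfSpace hT (κ.adj m) h1 h2 hst
        exact hex m ht
      obtain ⟨M, hM⟩ := κ.exists_notMem_half hT (ℓ.vertex (n + 1))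
      exact absurd (hall M) (hM M le_rfl)
  obtain ⟨j, hj, -⟩ := key N le_rfl
  refine ⟨N, j, fun k => ?_⟩
  induction k with
  | zero => exact hj.symm
  | succ k ih =>
    obtain ⟨i, hi1, hi2⟩ := key (N + k) (by omega)
    have : (i : ℤ) = (j + k : ℕ) := κ.injective hT (hi1.trans ih)
    rw [this] at hi2
    change ℓ.vertex ((N + (k + 1) : ℕ) : ℤ) = κ.vertex ((j + (k + 1) : ℕ) : ℤ)
    rw [← add_assoc, ← add_assoc, Nat.cast_succ, Nat.cast_succ]
    exact hi2.symm

end Line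

end TreeAction

namespace TreeAction

variable {V : Type*} {T : SimpleGraph V}

/-! ### Axes of hyperbolic automorphisms -/

/-- The line `ℓ` is translated forward by `φ` by the amount `l`. -/
structure Line.IsAxis (ℓ : Line T) (φ : T ≃g T) (l : ℕ) : Prop where
  pos : 0 < l
  map : ∀ i, φ (ℓ.vertex i) = ℓ.vertex (i + l)

/-- A vertex of minimal displacement is moved to a different vertex, and the neighbour of its image
on a geodesic is not the image of the neighbour. -/
theorem IsHyperbolic.ne_of_minimal (hT : T.IsTree) {φ : T ≃g T} (hφ : IsHyperbolic φ) {l : ℕ}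
    {f : ℕ → V} (hl : ∀ y, l ≤ T.dist y (φ y)) (hfl : f l = φ (f 0))
    (hadj : ∀ i < l, T.Adj (f i) (f (i + 1))) (hpos : 0 < l) : f (l - 1) ≠ φ (f 1) := by
  intro h
  have hdist : ∀ k, 1 + k ≤ l → T.dist (f 1) (f (1 + k)) ≤ k := by
    intro k
    induction k with
    | zero => simp
    | succ k ih =>
      intro hk
      have := ih (by omega)
      have := hT.dist_eq_dist_add_one_of_adj (f 1) (hadj (1 + k) (by omega))
      rw [← add_assoc]
      omega
  obtain rfl | hl2 : l = 1 ∨ 2 ≤ l := by omega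
  -- For `l = 1` the two endpoints are exchanged, so an edge is inverted.
  · refine hφ (Or.inr ⟨⟨s(f 0, f 1), hadj 0 one_pos⟩, Subtype.ext ?_⟩)
    change s(φ (f 0), φ (f 1)) = s(f 0, f 1)
    rw [← h, ← hfl, Sym2.eq_swap]
  -- For `l ≥ 2` the vertex `f 1` would be displaced by at most `l - 2`.
  · have h1 := hl (f 1)
    rw [← h] at h1
    have h2 := hdist (l - 2) (by omega)
    rw [show 1 + (l - 2) = l - 1 by omega] at h2
    omega

/-- A geodesic from a vertex of minimal displacement to its image is concatenated with all its
translates. Minimality excludes backtracking where two translates meet. -/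
theorem IsHyperbolic.exists_axis (hT : T.IsTree) {φ : T ≃g T} (hφ : IsHyperbolic φ) :
    ∃ (ℓ : Line T) (l : ℕ), ℓ.IsAxis φ l := by
  classical
  obtain ⟨v₀⟩ := hT.connected.nonempty
  have hex : ∃ n x, T.dist x (φ x) = n := ⟨_, v₀, rfl⟩
  obtain ⟨l, hlx, hmin⟩ : ∃ l, (∃ x, T.dist x (φ x) = l) ∧ ∀ y, l ≤ T.dist y (φ y) :=
    ⟨Nat.find hex, Nat.find_spec hex, fun y => Nat.find_min' hex ⟨y, rfl⟩⟩
  obtain ⟨x, hx⟩ := hlx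
  obtain ⟨p, hp⟩ := hT.connected.exists_walk_length_eq_dist x (φ x)
  have hpath := p.isPath_of_length_eq_dist hp
  rw [hx] at hp
  have hpos : 0 < l := by
    rw [Nat.pos_iff_ne_zero]
    rintro rfl
    exact hφ (Or.inl ⟨x, (hT.connected.dist_eq_zero_iff.1 hx).symm⟩)
  obtain ⟨f, hf⟩ : ∃ f, f = p.getVert := ⟨_, rfl⟩
  have hfl : f l = φ (f 0) := by rw [hf, ← hp]; simp
  have hadj : ∀ i < l, T.Adj (f i) (f (i + 1)) := fun i hi =>
    hf ▸ p.adj_getVert_succ (hp ▸ hi)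
  have hinj : ∀ i, i + 2 ≤ l → f i ≠ f (i + 2) := by
    intro i hi h
    have := hpath.getVert_injOn (by simp; omega) (by simp; omega) (hf ▸ h)
    omega
  have hback := hφ.ne_of_minimal hT hmin hfl hadj hpos
  have hl0 : (l : ℤ) ≠ 0 := by exact_mod_cast hpos.ne'
  obtain ⟨v, hv⟩ : ∃ v : ℤ → V, ∀ i, v i = (φ ^ (i / l)) (f (i % l).toNat) := ⟨_, fun _ => rfl⟩
  have hlt : ∀ (q : ℤ) (j : ℕ), j < l → v (q * l + j) = (φ ^ q) (f j) := by
    intro q j hj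
    have h1 : ((j : ℤ)) % l = j := Int.emod_eq_of_lt (by omega) (by omega)
    have h2 : ((j : ℤ)) / l = 0 := Int.ediv_eq_zero_of_lt (by omega) (by omega)
    rw [hv, add_comm, Int.add_mul_ediv_right _ _ hl0, Int.add_mul_emod_self_right, h1, h2]
    simp
  have hsucc : ∀ (q : ℤ) (y : V), (φ ^ (q + 1)) y = (φ ^ q) (φ y) := by
    intro q y
    rw [zpow_add_one]
    rfl
  have hle : ∀ (q : ℤ) (j : ℕ), j ≤ l → v (q * l + j) = (φ ^ q) (f j) := by
    intro q j hj
    rcases hj.lt_or_eq with hj | rfl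
    · exact hlt q j hj
    · have := hlt (q + 1) 0 hpos
      rw [hsucc, ← hfl] at this
      rw [← this]
      congr 1
      push_cast
      ring
  have hdecomp : ∀ i : ℤ, ∃ (q : ℤ) (j : ℕ), j < l ∧ i = q * l + j := by
    intro i
    have h1 := Int.emod_nonneg i hl0
    have h2 := Int.emod_lt_of_pos i (by exact_mod_cast hpos : (0 : ℤ) < l)
    refine ⟨i / l, (i % l).toNat, by omega, ?_⟩
    rw [Int.toNat_of_nonneg h1, mul_comm]
    exact (Int.mul_ediv_add_emod i l).symm
  refine ⟨⟨v, fun i => ?_, fun i => ?_⟩, l, hpos, fun i => ?_⟩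
  · obtain ⟨q, j, hj, rfl⟩ := hdecomp i
    rw [hlt q j hj, add_assoc, show (j : ℤ) + 1 = (j + 1 : ℕ) by simp, hle q (j + 1) hj]
    exact (φ ^ q).map_adj_iff.2 (hadj j hj)
  · obtain ⟨q, j, hj, rfl⟩ := hdecomp i
    rw [hlt q j hj]
    by_cases hj2 : j + 2 ≤ l
    · rw [add_assoc, show (j : ℤ) + 2 = (j + 2 : ℕ) by simp, hle q (j + 2) hj2]
      exact fun h => hinj j hj2 ((φ ^ q).injective h)
    -- Here the middle vertex is the junction of two translates, where `hback` applies.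
    · have hj1 : j = l - 1 := by omega
      have hl1 := hle (q + 1) 1 hpos
      rw [hsucc] at hl1
      have : q * l + j + 2 = (q + 1) * l + (1 : ℕ) := by
        rw [add_mul, one_mul]
        push_cast
        omega
      rw [this, hl1, hj1]
      exact fun h => hback ((φ ^ q).injective h)
  · obtain ⟨q, j, hj, rfl⟩ := hdecomp i
    have h1 := hlt (q + 1) j hj
    rw [add_comm q, zpow_add, zpow_one] at h1
    change φ (v (q * l + j)) = v (q * l + j + l)
    rw [hlt q j hj, show q * l + j + l = (1 + q) * l + j by ring, h1]
    rfl

/-! ### The action of a translation on the half-spaces and ends of its axis. -/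

namespace Line

variable {ℓ : Line T} {φ : T ≃g T} {l : ℕ}

theorem IsAxis.pow_map (h : ℓ.IsAxis φ l) (n : ℕ) (i : ℤ) :
    (φ ^ n) (ℓ.vertex i) = ℓ.vertex (i + (n * l : ℕ)) := by
  induction n with
  | zero => simp
  | succ n ih =>
    rw [pow_succ', RelIso.mul_apply, ih, h.map]
    congr 1
    push_cast
    ring

theorem IsAxis.image_half (hT : T.IsTree) (h : ℓ.IsAxis φ l) (i : ℤ) :
    φ '' ℓ.half i = ℓ.half (i + l) := by
  rw [half, image_halfSpace hT, h.map, h.map, half]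
  congr 2
  ring

theorem IsAxis.map_ray (hT : T.IsTree) (h : ℓ.IsAxis φ l) :
    Boundary.map φ (Quotient.mk _ (ℓ.ray hT)) = Quotient.mk _ (ℓ.ray hT) := by
  refine Quotient.sound ⟨0, l, fun k => ?_⟩
  change φ (ℓ.vertex _) = ℓ.vertex _
  rw [h.map]
  congr 1
  push_cast
  ring

theorem IsAxis.map_ray_reverse (hT : T.IsTree) (h : ℓ.IsAxis φ l) :
    Boundary.map φ (Quotient.mk _ (ℓ.reverse.ray hT)) = Quotient.mk _ (ℓ.reverse.ray hT) := by
  refine Quotient.sound ⟨l, 0, fun k => ?_⟩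
  change φ (ℓ.vertex (-_)) = ℓ.vertex (-_)
  rw [h.map]
  congr 1
  push_cast
  ring

/-- Far half-spaces along the axes of transverse automorphisms are disjoint. -/
theorem exists_forall_disjoint_half (hT : T.IsTree) {ψ : T ≃g T} (h : IsTransverse φ ψ)
    {ℓ κ : Line T} (hℓ : Boundary.map φ (Quotient.mk _ (ℓ.ray hT)) = Quotient.mk _ (ℓ.ray hT))
    (hκ : Boundary.map ψ (Quotient.mk _ (κ.ray hT)) = Quotient.mk _ (κ.ray hT)) :
    ∃ N : ℕ, ∀ n : ℕ, N ≤ n → Disjoint (ℓ.half n) (κ.half n) := by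
  by_contra! hcon
  have hmeet : ∀ n : ℕ, (ℓ.half n ∩ κ.half n).Nonempty := by
    intro n
    obtain ⟨k, hk, hd⟩ := hcon n
    obtain ⟨w, h1, h2⟩ := Set.not_disjoint_iff.1 hd
    have hk' : (n : ℤ) ≤ k := by exact_mod_cast hk
    exact ⟨w, ℓ.half_antitone hT hk' h1, κ.half_antitone hT hk' h2⟩
  have heq : (Quotient.mk _ (ℓ.ray hT) : Boundary T) = Quotient.mk _ (κ.ray hT) :=
    Quotient.sound (cofinal_of_nonempty_inter hT ℓ κ hmeet)
  exact h _ ⟨hℓ, heq ▸ hκ⟩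

end Line

/-- The displacement of the powers of a hyperbolic automorphism grows at least linearly. -/
theorem IsHyperbolic.exists_le_dist_pow (hT : T.IsTree) {φ : T ≃g T} (hφ : IsHyperbolic φ) :
    ∃ x, ∀ n : ℕ, n ≤ T.dist x ((φ ^ n) x) := by
  obtain ⟨ℓ, l, h⟩ := hφ.exists_axis hT
  refine ⟨ℓ.vertex 0, fun n => ?_⟩
  rw [h.pow_map, ℓ.dist_add hT]
  exact Nat.le_mul_of_pos_right n h.pos

end TreeAction

namespace TreeAction

/-! ### Means -/

namespace Mean

variable {X : Type*} (m : Mean X)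

theorem measure_empty : m.measure ∅ = 0 := by
  simpa using m.union ∅ ∅ (by simp)

theorem measure_mono {A B : Set X} (h : A ⊆ B) : m.measure A ≤ m.measure B := by
  have := m.union A (B \ A) disjoint_sdiff_self_right
  rw [Set.union_sdiff_cancel h] at this
  linarith [m.nonneg (B \ A)]

theorem measure_union_le (A B : Set X) :
    m.measure (A ∪ B) ≤ m.measure A + m.measure B := by
  have := m.union A (B \ A) disjoint_sdiff_self_right
  rw [Set.union_sdiff_self] at this
  linarith [m.measure_mono (Set.sdiff_subset (s := B) (t := A))]

theorem measure_eq_zero_of_subset {A B : Set X} (h : A ⊆ B) (hB : m.measure B = 0) :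
    m.measure A = 0 :=
  le_antisymm (hB ▸ m.measure_mono h) (m.nonneg A)

theorem measure_union_eq_zero {A B : Set X} (hA : m.measure A = 0) (hB : m.measure B = 0) :
    m.measure (A ∪ B) = 0 :=
  le_antisymm (by simpa [hA, hB] using m.measure_union_le A B) (m.nonneg _)

/-- A set is null if it has infinitely many disjoint copies of the same measure. -/
theorem measure_eq_zero_of_pairwise_disjoint {D : ℕ → Set X}
    (hD : Pairwise (Function.onFun Disjoint D)) (h : ∀ n, m.measure (D n) = m.measure (D 0)) :
    m.measure (D 0) = 0 := by
  have hsum : ∀ n : ℕ, m.measure (⋃ k < n, D k) = n * m.measure (D 0) := by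
    intro n
    induction n with
    | zero => simp [m.measure_empty]
    | succ n ih =>
      rw [Set.biUnion_lt_succ, m.union, ih, h n]
      · push_cast
        ring
      · simp only [Set.disjoint_iUnion_left]
        exact fun k hk => hD hk.ne
  by_contra hne
  have hpos : 0 < m.measure (D 0) := lt_of_le_of_ne (m.nonneg _) (Ne.symm hne)
  obtain ⟨n, hn⟩ := exists_nat_gt (1 / m.measure (D 0))
  rw [div_lt_iff₀ hpos, ← hsum, ← m.univ] at hn
  exact absurd (m.measure_mono (Set.subset_univ _)) (not_le.2 hn)

end Mean

/-! ### Placements -/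

variable {V : Type*} {T : SimpleGraph V} {G : Type*} [Group G] {ρ : G →* (T ≃g T)}

theorem conjNeOne_conjNeOne_inv (h : G) (g : {g : G // g ≠ 1}) :
    conjNeOne h (conjNeOne h⁻¹ g) = g :=
  Subtype.ext (by simp [conjNeOne, mul_assoc])

theorem conjNeOne_injective (h : G) : Function.Injective (conjNeOne h) := by
  intro g g' hg
  simpa [conjNeOne, Subtype.ext_iff] using hg

/-- An equivariant assignment of the elements of `Y` to points or ends of the tree. The set `L A`
consists of the elements that are located in `A`. -/
structure IsPlacement (ρ : G →* (T ≃g T)) (Y : Set {g : G // g ≠ 1})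
    (L : Set V → Set {g : G // g ≠ 1}) : Prop where
  conj_mem : ∀ h A g, g ∈ L A → conjNeOne h g ∈ L (ρ h '' A)
  mono : Monotone L
  disjoint : ∀ A B, Disjoint A B → Disjoint (L A) (L B)
  cover : ∀ (ℓ : Line T) (i : ℤ), Y ⊆ L (ℓ.half i) ∪ L (ℓ.half (i + 1))ᶜ

namespace IsPlacement

variable {Y : Set {g : G // g ≠ 1}} {L : Set V → Set {g : G // g ≠ 1}}

theorem image (hL : IsPlacement ρ Y L) (h : G) (A : Set V) :
    conjNeOne h '' L A = L (ρ h '' A) := by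
  refine Set.Subset.antisymm ?_ fun g hg => ⟨conjNeOne h⁻¹ g, ?_, conjNeOne_conjNeOne_inv h g⟩
  · rintro _ ⟨g, hg, rfl⟩
    exact hL.conj_mem h A g hg
  · have := hL.conj_mem h⁻¹ _ g hg
    rw [Set.image_image] at this
    simpa [map_inv] using this

variable {m : Mean {g : G // g ≠ 1}} {a : G} {ℓ : Line T} {l : ℕ}

/-- Conjugation by `a` carries each such difference to the next one along the axis. These shells are
pairwise disjoint because the half-spaces are nested. -/
theorem measure_diff_shift (hT : T.IsTree) (hL : IsPlacement ρ Y L) (hm : m.IsConjInvariant)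
    (hℓ : ℓ.IsAxis (ρ a) l) (i : ℤ) :
    m.measure (L (ℓ.half i) \ L (ℓ.half (i + l))) = 0 := by
  have hstep : ∀ i : ℤ, m.measure (L (ℓ.half (i + l)) \ L (ℓ.half (i + l + l))) =
      m.measure (L (ℓ.half i) \ L (ℓ.half (i + l))) := by
    intro i
    have himage : ∀ i, L (ℓ.half (i + l)) = conjNeOne a '' L (ℓ.half i) := fun i => by
      rw [hL.image, hℓ.image_half hT]
    rw [himage (i + l), himage i, ← Set.image_sdiff (conjNeOne_injective a), ← himage i, hm]
  have := m.measure_eq_zero_of_pairwise_disjoint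
    (D := fun k : ℕ => L (ℓ.half (i + k * l)) \ L (ℓ.half (i + k * l + l))) ?_ ?_
  · simpa using this
  · refine (pairwise_disjoint_on _).2 fun k k' hk => ?_
    refine Set.disjoint_left.2 fun g hg hg' => hg.2 (hL.mono (ℓ.half_antitone hT ?_) hg'.1)
    have : (k : ℤ) + 1 ≤ k' := by exact_mod_cast hk
    nlinarith
  · intro n
    induction n with
    | zero => rfl
    | succ n ih =>
      rw [show i + (n + 1 : ℕ) * l = i + n * l + l by push_cast; ring, hstep, ih]

theorem measure_diff (hT : T.IsTree) (hL : IsPlacement ρ Y L) (hm : m.IsConjInvariant)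
    (hℓ : ℓ.IsAxis (ρ a) l) (i j : ℤ) : m.measure (L (ℓ.half i) \ L (ℓ.half j)) = 0 := by
  have key : ∀ k : ℕ, m.measure (L (ℓ.half i) \ L (ℓ.half (i + k * l))) = 0 := by
    intro k
    induction k with
    | zero => simp [m.measure_empty]
    | succ k ih =>
      refine m.measure_eq_zero_of_subset (fun g hg => ?_)
        (m.measure_union_eq_zero ih (hL.measure_diff_shift hT hm hℓ (i + k * l)))
      rw [show i + k * l + l = i + (k + 1 : ℕ) * l by push_cast; ring]
      by_cases h : g ∈ L (ℓ.half (i + k * l))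
      · exact Or.inr ⟨h, hg.2⟩
      · exact Or.inl ⟨hg.1, h⟩
  refine m.measure_eq_zero_of_subset (Set.sdiff_subset_sdiff_right (hL.mono ?_))
    (key (j - i).toNat)
  refine ℓ.half_antitone hT ?_
  have h1 : j - i ≤ (j - i).toNat := Int.self_le_toNat _
  have h2 : (1 : ℤ) ≤ l := by exact_mod_cast hℓ.pos
  nlinarith [Int.natCast_nonneg (j - i).toNat]

/-- Almost every element is located far out on the axis, in one of the two directions. -/
theorem measure_diff_ends (hT : T.IsTree) (hL : IsPlacement ρ Y L) (hm : m.IsConjInvariant)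
    (hℓ : ℓ.IsAxis (ρ a) l) (n : ℕ) :
    m.measure (Y \ (L (ℓ.half n) ∪ L (ℓ.reverse.half n))) = 0 := by
  -- The index `-n - 2` is chosen so that the complementary half-space in `cover`, one edge further
  -- on, is exactly `ℓ.reverse.half n`.
  refine m.measure_eq_zero_of_subset (fun g hg => ?_) (hL.measure_diff hT hm hℓ (-n - 2) n)
  have hrev : (ℓ.half (-n - 2 + 1))ᶜ = ℓ.reverse.half n := by
    rw [ℓ.compl_half hT]
    congr 1
    ring
  have h1 := hL.cover ℓ (-n - 2) hg.1
  rw [hrev] at h1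
  have h2 := hg.2
  simp only [Set.mem_union, not_or] at h1 h2
  exact ⟨h1.resolve_right h2.2, h2.1⟩

theorem measure_eq_zero (hT : T.IsTree) (hgen : IsGeneralType ρ) (hL : IsPlacement ρ Y L)
    (hm : m.IsConjInvariant) : m.measure Y = 0 := by
  obtain ⟨a, b, ha, hb, hab⟩ := hgen
  obtain ⟨ℓ, l, hℓ⟩ := ha.exists_axis hT
  obtain ⟨κ, k, hκ⟩ := hb.exists_axis hT
  obtain ⟨N₁, h₁⟩ := Line.exists_forall_disjoint_half hT hab (hℓ.map_ray hT) (hκ.map_ray hT)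
  obtain ⟨N₂, h₂⟩ := Line.exists_forall_disjoint_half hT hab (hℓ.map_ray hT) (hκ.map_ray_reverse hT)
  obtain ⟨N₃, h₃⟩ := Line.exists_forall_disjoint_half hT hab (hℓ.map_ray_reverse hT) (hκ.map_ray hT)
  obtain ⟨N₄, h₄⟩ := Line.exists_forall_disjoint_half hT hab (hℓ.map_ray_reverse hT)
    (hκ.map_ray_reverse hT)
  obtain ⟨n, e₁, e₂, e₃, e₄⟩ : ∃ n, N₁ ≤ n ∧ N₂ ≤ n ∧ N₃ ≤ n ∧ N₄ ≤ n :=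
    ⟨N₁ + N₂ + N₃ + N₄, by omega, by omega, by omega, by omega⟩
  -- An element outside both null sets would lie near an end of `ℓ` and near an end of `κ`, and each
  -- of the four combinations is disjoint.
  refine m.measure_eq_zero_of_subset (B := _ ∪ _) (fun g hg => ?_) (m.measure_union_eq_zero
    (hL.measure_diff_ends hT hm hℓ n) (hL.measure_diff_ends hT hm hκ n))
  have d₁ := (hL.disjoint _ _ (h₁ n e₁)).notMem_of_mem_left (a := g)
  have d₂ := (hL.disjoint _ _ (h₂ n e₂)).notMem_of_mem_left (a := g)
  have d₃ := (hL.disjoint _ _ (h₃ n e₃)).notMem_of_mem_left (a := g)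
  have d₄ := (hL.disjoint _ _ (h₄ n e₄)).notMem_of_mem_left (a := g)
  simp only [Set.mem_union, Set.mem_sdiff]
  tauto

end IsPlacement

/-! ### Hyperbolic elements -/

/-- The elements whose powers move every vertex into `A`, along a fixed ultrafilter. -/
def attracted (ρ : G →* (T ≃g T)) (A : Set V) : Set {g : G // g ≠ 1} :=
  {g | ∀ x, ∀ᶠ n in (Filter.hyperfilter ℕ : Filter ℕ), ρ ((g : G) ^ n) x ∈ A}

/-- If two sequences of vertices are at bounded distance and one of them escapes to infinity, then
they lie eventually on the same side of an edge. -/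
theorem IsHyperbolic.eventually_mem (hT : T.IsTree) {φ : T ≃g T} (hφ : IsHyperbolic φ) {u v : V}
    (huv : T.Adj u v) (x y : V) :
    ∀ᶠ n in Filter.atTop, (φ ^ n) x ∈ halfSpace T u v → (φ ^ n) y ∈ halfSpace T u v := by
  obtain ⟨z, hz⟩ := hφ.exists_le_dist_pow hT
  filter_upwards [Filter.eventually_gt_atTop (T.dist z u + T.dist z x + T.dist y x)] with n hn hx
  by_contra hy
  have h1 := dist_add_dist_le hT huv hx hy
  rw [dist_map hT] at h1
  have h2 := hz n
  have h3 := hT.connected.dist_triangle (u := z) (v := u) (w := (φ ^ n) z)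
  have h4 := hT.connected.dist_triangle (u := (φ ^ n) z) (v := (φ ^ n) x) (w := u)
  rw [dist_map hT, T.dist_comm (u := (φ ^ n) z)] at h4
  omega

/-- The ultrafilter decides on which side of an edge the orbit of one vertex lies. By
`IsHyperbolic.eventually_mem` all vertices give the same answer. -/
theorem isPlacement_attracted (hT : T.IsTree) (ρ : G →* (T ≃g T)) :
    IsPlacement ρ {g | IsHyperbolic (ρ g)} (attracted ρ) where
  conj_mem h A g hg x := by
    filter_upwards [hg (ρ h⁻¹ x)] with n hn
    refine ⟨_, hn, ?_⟩
    simp [conjNeOne, conj_pow]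
  mono A B hAB g hg x := (hg x).mono fun _ hn => hAB hn
  disjoint A B hAB := by
    refine Set.disjoint_left.2 fun g hA hB => ?_
    obtain ⟨x⟩ := hT.connected.nonempty
    obtain ⟨n, h1, h2⟩ := ((hA x).and (hB x)).exists
    exact Set.disjoint_left.1 hAB h1 h2
  cover ℓ i g hg := by
    obtain ⟨x₀⟩ := hT.connected.nonempty
    have hev : ∀ x y, ∀ᶠ n in (Filter.hyperfilter ℕ : Filter ℕ),
        ρ ((g : G) ^ n) x ∈ ℓ.half i → ρ ((g : G) ^ n) y ∈ ℓ.half i := fun x y => by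
      have := hg.eventually_mem hT (ℓ.adj i) x y
      simp only [← map_pow] at this
      exact Nat.hyperfilter_le_atTop this
    rcases Ultrafilter.em (Filter.hyperfilter ℕ) fun n => ρ ((g : G) ^ n) x₀ ∈ ℓ.half i with h | h
    · refine Or.inl fun x => ?_
      filter_upwards [h, hev x₀ x] with n h1 h2 using h2 h1
    · refine Or.inr fun x => ?_
      filter_upwards [h, hev x x₀] with n h1 h2
      exact fun h3 => h1 (h2 (ℓ.half_antitone hT (by omega) h3))

end TreeAction

namespace TreeAction

variable {V : Type*} {T : SimpleGraph V}

/-! ### Centers of bounded sets -/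

/-- The smallest radius of a ball that contains `S`. -/
noncomputable def circumradius (T : SimpleGraph V) (S : Set V) : ℕ :=
  sInf {n | ∃ x, ∀ s ∈ S, T.dist x s ≤ n}

/-- The centers of the balls of smallest radius that contain `S`. -/
def center (T : SimpleGraph V) (S : Set V) : Set V :=
  {x | ∀ s ∈ S, T.dist x s ≤ circumradius T S}

/-- Boundedness ensures that the infimum is attained. For an unbounded set `circumradius` takes the
default value `0`. -/
theorem center_nonempty {S : Set V} {n : ℕ} {x : V} (h : ∀ s ∈ S, T.dist x s ≤ n) :
    (center T S).Nonempty :=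
  Nat.sInf_mem (s := {n | ∃ x, ∀ s ∈ S, T.dist x s ≤ n}) ⟨n, x, h⟩

/-- The center of a set is contained in an edge. -/
theorem dist_le_one_of_mem_center (hT : T.IsTree) {S : Set V} (hS : S.Nonempty) {x y : V}
    (hx : x ∈ center T S) (hy : y ∈ center T S) : T.dist x y ≤ 1 := by
  by_contra! h
  have hne : y ≠ x := by rintro rfl; simp at h
  obtain ⟨z, hz, hd⟩ := exists_adj_dist_succ hT hne
  rw [T.dist_comm (u := y) (v := x)] at hd
  -- The vertex `z` is interior to the geodesic from `y` to `x`, so it is strictly closer to each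
  -- `s` than one of `x` and `y` is. It therefore centers a ball of smaller radius.
  have key : ∀ s ∈ S, T.dist z s + 1 ≤ circumradius T S := by
    intro s hs
    have h1 := hx s hs
    have h2 := hy s hs
    rw [T.dist_comm] at h1
    rw [T.dist_comm (u := z)]
    by_cases h3 : s ∈ halfSpace T z x
    · have := dist_add_dist_le hT (t := y) hz h3 (by
        rw [mem_halfSpace, T.dist_comm (u := y) (v := x)]; omega)
      omega
    · have := hT.dist_eq_dist_add_one_of_adj s hz
      rw [mem_halfSpace] at h3
      omega
  -- A point of `S` makes the circumradius positive, so the truncated subtraction below is a genuine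
  -- decrease.
  obtain ⟨s, hs⟩ := hS
  have h1 := key s hs
  have h2 : circumradius T S ≤ circumradius T S - 1 :=
    Nat.sInf_le ⟨z, fun s hs => by have := key s hs; omega⟩
  omega

theorem circumradius_image (hT : T.IsTree) (φ : T ≃g T) (S : Set V) :
    circumradius T (φ '' S) = circumradius T S := by
  have key : ∀ n, (∃ x, ∀ s ∈ φ '' S, T.dist x s ≤ n) ↔ ∃ x, ∀ s ∈ S, T.dist x s ≤ n := by
    intro n
    rw [φ.surjective.exists]
    simp only [Set.forall_mem_image, dist_map hT]
  simp only [circumradius, key]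

theorem center_image (hT : T.IsTree) (φ : T ≃g T) (S : Set V) :
    center T (φ '' S) = φ '' center T S := by
  ext x
  obtain ⟨x, rfl⟩ := φ.surjective x
  simp [center, circumradius_image hT, dist_map hT]

/-! ### The frontier of the fixed set -/

/-- The vertices of `T` in the closed cell of a vertex of the barycentric subdivision. -/
def cell : V ⊕ T.edgeSet → Set V
  | .inl v => {v}
  | .inr e => {x | x ∈ (e : Sym2 V)}

theorem cell_nonempty (t : V ⊕ T.edgeSet) : (cell t).Nonempty := by
  rcases t with v | ⟨e, he⟩
  · exact ⟨v, rfl⟩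
  · induction e using Sym2.ind with
    | _ x y => exact ⟨x, Sym2.mem_mk_left x y⟩

theorem dist_le_one_of_mem_cell {t : V ⊕ T.edgeSet} {x y : V} (hx : x ∈ cell t)
    (hy : y ∈ cell t) : T.dist x y ≤ 1 := by
  by_cases hxy : x = y
  · simp [hxy]
  rcases t with v | ⟨e, he⟩
  · exact absurd (hx.trans hy.symm) hxy
  · have hxe : x ∈ e := hx
    have hye : y ∈ e := hy
    rw [(Sym2.mem_and_mem_iff hxy).1 ⟨hxe, hye⟩, SimpleGraph.mem_edgeSet] at he
    exact (SimpleGraph.dist_eq_one_iff_adj.2 he).le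

theorem cell_inter_nonempty {s t : V ⊕ T.edgeSet} (h : (subdivision T).Adj s t) :
    (cell s ∩ cell t).Nonempty := by
  rcases s with v | e <;> rcases t with w | f
  · exact h.elim
  · exact ⟨v, rfl, h⟩
  · exact ⟨w, h, rfl⟩
  · exact h.elim

/-- Consecutive cells share a vertex, so each step costs at most one. The extra one is the width of
the last cell. -/
theorem dist_le_length_add_one (hT : T.IsTree) {s t : V ⊕ T.edgeSet}
    (p : (subdivision T).Walk s t) {x y : V} (hx : x ∈ cell s) (hy : y ∈ cell t) :
    T.dist x y ≤ p.length + 1 := by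
  induction p generalizing x with
  | nil => simpa using dist_le_one_of_mem_cell hx hy
  | cons h p ih =>
    obtain ⟨z, hz, hz'⟩ := cell_inter_nonempty h
    have h1 := dist_le_one_of_mem_cell hx hz
    have h2 := ih hz' hy
    have h3 := hT.connected.dist_triangle (u := x) (v := z) (w := y)
    rw [SimpleGraph.Walk.length_cons]
    omega

/-- The vertices of `T` in the closed cells of the frontier of the fixed set. -/
def shadow (φ : T ≃g T) : Set V := ⋃ t ∈ frontierFix φ, cell t

theorem subdivisionMap_mul (φ ψ : T ≃g T) (t : V ⊕ T.edgeSet) :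
    subdivisionMap (φ * ψ) t = subdivisionMap φ (subdivisionMap ψ t) := by
  rcases t with v | e
  · rfl
  · refine congrArg Sum.inr (Subtype.ext ?_)
    exact (Sym2.map_map (g := φ) (f := ψ) (e : Sym2 V)).symm

theorem subdivisionMap_one (t : V ⊕ T.edgeSet) : subdivisionMap (1 : T ≃g T) t = t := by
  rcases t with v | e
  · rfl
  · refine congrArg Sum.inr (Subtype.ext ?_)
    exact congrFun Sym2.map_id (e : Sym2 V)

theorem subdivisionMap_adj (φ : T ≃g T) {s t : V ⊕ T.edgeSet} (h : (subdivision T).Adj s t) :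
    (subdivision T).Adj (subdivisionMap φ s) (subdivisionMap φ t) := by
  rcases s with v | e <;> rcases t with w | f
  · exact h.elim
  · exact Sym2.mem_map.2 ⟨v, h, rfl⟩
  · exact Sym2.mem_map.2 ⟨w, h, rfl⟩
  · exact h.elim

theorem map_mem_cell (φ : T ≃g T) {t : V ⊕ T.edgeSet} {x : V} (hx : x ∈ cell t) :
    φ x ∈ cell (subdivisionMap φ t) := by
  rcases t with v | e
  · exact congrArg φ hx
  · exact Sym2.mem_map.2 ⟨x, hx, rfl⟩

theorem subdivisionMap_mem_frontierFix (φ ψ : T ≃g T) {t : V ⊕ T.edgeSet}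
    (h : t ∈ frontierFix φ) : subdivisionMap ψ t ∈ frontierFix (ψ * φ * ψ⁻¹) := by
  have key : ∀ t, subdivisionMap (ψ * φ * ψ⁻¹) (subdivisionMap ψ t) =
      subdivisionMap ψ (subdivisionMap φ t) := by
    intro t
    rw [← subdivisionMap_mul, inv_mul_cancel_right, subdivisionMap_mul]
  obtain ⟨h1, s, hs, h2⟩ := h
  refine ⟨by rw [key, h1], subdivisionMap ψ s, subdivisionMap_adj ψ hs, fun h3 => h2 ?_⟩
  rw [key] at h3
  have := congrArg (subdivisionMap ψ⁻¹) h3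
  simpa only [← subdivisionMap_mul ψ⁻¹ ψ, inv_mul_cancel, subdivisionMap_one] using this

theorem image_shadow (φ ψ : T ≃g T) : ψ '' shadow φ = shadow (ψ * φ * ψ⁻¹) := by
  have key : ∀ φ ψ : T ≃g T, ∀ x ∈ shadow φ, ψ x ∈ shadow (ψ * φ * ψ⁻¹) := by
    intro φ ψ x hx
    simp only [shadow, Set.mem_iUnion] at hx ⊢
    obtain ⟨t, ht, hxt⟩ := hx
    exact ⟨_, subdivisionMap_mem_frontierFix φ ψ ht, map_mem_cell ψ hxt⟩
  refine Set.Subset.antisymm (Set.image_subset_iff.2 (key φ ψ)) fun x hx => ⟨ψ⁻¹ x, ?_, ?_⟩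
  · have := key _ ψ⁻¹ x hx
    simpa [mul_assoc] using this
  · exact RelIso.apply_inv_self ψ x

/-- A path from a fixed vertex to a moved one leaves the fixed set somewhere. Without fixed
vertices, the midpoint of an inverted edge is itself in the frontier. -/
theorem frontierFix_nonempty (hT : T.IsTree) {φ : T ≃g T} (hφ : IsElliptic φ) (hne : φ ≠ 1) :
    (frontierFix φ).Nonempty := by
  by_cases hv : ∃ v, φ v = v
  · obtain ⟨v, hv⟩ := hv
    obtain ⟨w, hw⟩ : ∃ w, φ w ≠ w := by
      by_contra! h
      exact hne (RelIso.ext h)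
    obtain ⟨p⟩ := hT.connected v w
    obtain ⟨d, -, h1, h2⟩ := p.exists_boundary_dart {x | φ x = x} hv hw
    refine ⟨.inl d.fst, congrArg Sum.inl h1, .inr ⟨s(d.fst, d.snd), d.adj⟩,
      Sym2.mem_mk_left _ _, fun h => h2 ?_⟩
    have h3 : s(φ d.fst, φ d.snd) = s(d.fst, d.snd) := congrArg Subtype.val (Sum.inr_injective h)
    rw [show φ d.fst = d.fst from h1] at h3
    exact Sym2.congr_right.1 h3
  · obtain ⟨e, he⟩ := hφ.resolve_left hv
    obtain ⟨x, hx⟩ := cell_nonempty (.inr e : V ⊕ T.edgeSet)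
    exact ⟨.inr e, congrArg Sum.inr he, .inl x, hx, fun h => hv ⟨x, Sum.inl_injective h⟩⟩

theorem shadow_nonempty (hT : T.IsTree) {φ : T ≃g T} (hφ : IsElliptic φ) (hne : φ ≠ 1) :
    (shadow φ).Nonempty := by
  obtain ⟨t, ht⟩ := frontierFix_nonempty hT hφ hne
  obtain ⟨x, hx⟩ := cell_nonempty t
  exact ⟨x, Set.mem_biUnion ht hx⟩

theorem exists_dist_le_of_setDiam_ne_top (hT : T.IsTree) {φ : T ≃g T}
    (h : setDiam (subdivision T) (fledge φ) ≠ ⊤) :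
    ∃ n : ℕ, ∀ x ∈ shadow φ, ∀ y ∈ shadow φ, T.dist x y ≤ n := by
  obtain ⟨D, hD⟩ := ENat.ne_top_iff_exists.1 h
  refine ⟨D + 1, fun x hx y hy => ?_⟩
  simp only [shadow, Set.mem_iUnion] at hx hy
  obtain ⟨s, hs, hxs⟩ := hx
  obtain ⟨t, ht, hyt⟩ := hy
  have hsub : frontierFix φ ⊆ fledge φ := Set.subset_sInter fun C hC => hC.1
  have hst : (subdivision T).edist s t ≤ D := by
    rw [hD]
    exact (le_iSup₂ (f := fun y (_ : y ∈ fledge φ) => (subdivision T).edist s y) t (hsub ht)).trans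
      (le_iSup₂ (f := fun x (_ : x ∈ fledge φ) => ⨆ y ∈ fledge φ, (subdivision T).edist x y)
        s (hsub hs))
  obtain ⟨p, hp⟩ := SimpleGraph.exists_walk_of_edist_ne_top
    (ne_top_of_le_ne_top (ENat.natCast_ne_top D) hst)
  rw [← hp, Nat.cast_le] at hst
  have := dist_le_length_add_one hT p hxs hyt
  omega

/-! ### Finitely fledged elements -/

variable {G : Type*} [Group G]

/-- The elements whose frontier of the fixed set has its center in `A`. -/
def centered (ρ : G →* (T ≃g T)) (A : Set V) : Set {g : G // g ≠ 1} :=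
  {g | (center T (shadow (ρ g))).Nonempty ∧ center T (shadow (ρ g)) ⊆ A}

/-- The center may be a whole edge, which can straddle the boundary of a half-space. The overlap of
one edge in `cover` absorbs this. -/
theorem isPlacement_centered (hT : T.IsTree) {ρ : G →* (T ≃g T)} (hρ : Function.Injective ρ) :
    IsPlacement ρ {g | IsElliptic (ρ g) ∧ setDiam (subdivision T) (fledge (ρ g)) ≠ ⊤}
      (centered ρ) where
  conj_mem h A g hg := by
    have key : center T (shadow (ρ (conjNeOne h g))) = ρ h '' center T (shadow (ρ g)) := by
      rw [← center_image hT, image_shadow]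
      simp [conjNeOne]
    rw [centered, Set.mem_ofPred_eq, key]
    exact ⟨hg.1.image _, Set.image_mono hg.2⟩
  mono A B hAB g hg := ⟨hg.1, hg.2.trans hAB⟩
  disjoint A B hAB := by
    refine Set.disjoint_left.2 fun g hA hB => ?_
    obtain ⟨x, hx⟩ := hA.1
    exact Set.disjoint_left.1 hAB (hA.2 hx) (hB.2 hx)
  cover ℓ i g hg := by
    -- Faithfulness makes the frontier nonempty, without which the center would not be confined to
    -- an edge.
    have hne : ρ g ≠ 1 := fun h => g.2 (hρ (h.trans (map_one ρ).symm))
    have hS := shadow_nonempty hT hg.1 hne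
    obtain ⟨n, hn⟩ := exists_dist_le_of_setDiam_ne_top hT hg.2
    obtain ⟨x₀, hx₀⟩ := hS
    have hC : (center T (shadow (ρ g))).Nonempty := center_nonempty (hn x₀ hx₀)
    by_cases hsub : center T (shadow (ρ g)) ⊆ ℓ.half i
    · exact Or.inl ⟨hC, hsub⟩
    · refine Or.inr ⟨hC, fun y hy hyi => ?_⟩
      obtain ⟨x, hx, hxi⟩ := Set.not_subset.1 hsub
      have hyi' : y ∈ ℓ.half i := ℓ.half_antitone hT (by omega) hyi
      have hxy : y ≠ x := fun h => hxi (h ▸ hyi')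
      have hadj : T.Adj y x := by
        rw [← SimpleGraph.dist_eq_one_iff_adj]
        have := dist_le_one_of_mem_center hT ⟨x₀, hx₀⟩ hy hx
        have := hT.connected.pos_dist_of_ne hxy
        omega
      -- The center would be the `i`-th edge of `ℓ`, but `ℓ.vertex (i + 1)` is not in `ℓ.half (i +
      -- 1)`.
      obtain ⟨rfl, -⟩ := eq_of_adj_of_mem_halfSpace hT (ℓ.adj i) hyi' hxi hadj
      exact absurd ((ℓ.vertex_mem_half hT).1 hyi) (lt_irrefl _)

end TreeAction

theorem mainTheorem8 {V : Type*} (T : SimpleGraph V) (hT : T.IsTree)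
    {G : Type*} [Group G] (ρ : G →* (T ≃g T)) (hfaithful : Function.Injective ρ)
    (hgen : TreeAction.IsGeneralType ρ)
    (m : TreeAction.Mean {g : G // g ≠ 1}) (hm : m.IsConjInvariant) :
    m.IsSupportedOn {g | TreeAction.IsInfinitelyFledged ρ g} := by
  have h1 := (TreeAction.isPlacement_attracted hT ρ).measure_eq_zero hT hgen hm
  have h2 := (TreeAction.isPlacement_centered hT hfaithful).measure_eq_zero hT hgen hm
  have h3 := m.union {g | TreeAction.IsInfinitelyFledged ρ g}
    {g | TreeAction.IsInfinitelyFledged ρ g}ᶜ disjoint_compl_right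
  have h4 : m.measure {g | TreeAction.IsInfinitelyFledged ρ g}ᶜ = 0 := by
    refine m.measure_eq_zero_of_subset (fun g hg => ?_) (m.measure_union_eq_zero h1 h2)
    by_cases he : TreeAction.IsElliptic (ρ g)
    · exact Or.inr ⟨he, fun h => hg ⟨he, h⟩⟩
    · exact Or.inl he
  rw [Set.union_compl_self, m.univ, h4, add_zero] at h3
  exact h3.symm
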